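/- **Theorem.** Setting. Let $\mathcal X$ be a measurable space with a $\sigma$-finite measure $\mu$, let $\Theta\subseteq\mathbb R^k$, and let $\{p_\theta:\theta\in\Theta\}$ be a jointly measurable family of probability densities with respect to $\mu$; let $\theta_0\in\Theta$. Under $P_{\theta_0}^{(n)}$ the observations $X^{(n)}=(X_1,\dots,X_n)$ are i.i.d. with density $p_{\theta_0}$. Let $\Pi_n$ be a prior probability measure on $\Theta$ (a fixed prior is the case $\Pi_n=\Pi$). Let $\boldsymbol w=\boldsymbol w_n\in\mathbb R^n$ be a random weight vector, independent of the data, with law $P_{\boldsymbol w}$. For fixed $\boldsymbol w$ put $p_\theta^{(n),\boldsymbol w}(X^{(n)})=\prod_{i=1}^n p_\theta(X_i)^{w_i}$, and let $\Pi_{\boldsymbol w}(\cdot\mid X^{(n)})$ be the weighted posterior $$\Pi_{\boldsymbol w}(A\mid X^{(n)})=\frac{\int_A p_\theta^{(n),\boldsymbol w}(X^{(n)})\,d\Pi_n(\theta)}{\int_\Theta p_\theta^{(n),\boldsymbol w}(X^{(n)})\,d\Pi_n(\theta)}.$$ For $c_0>0$ let $R_n(c_0)=\{a\in\mathbb R^n: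 a_i\ge 0,\ \sum_{i=1}^n a_i=n,\ \max_i a_i\le c_0\log n\}$. Define the misspecified densities $$\tilde p_\theta^{(n),\boldsymbol w}=\frac{1}{C_{\theta,\boldsymbol w}}\prod_{i=1}^n p_\theta(X_i)^{w_i}p_{\theta_0}(X_i)^{1-w_i},\qquad C_{\theta,\boldsymbol w}=\int\prod_{i=1}^n p_\theta(x_i)^{w_i}p_{\theta_0}(x_i)^{1-w_i}\,d\mu^{n}(x),$$ with laws $\tilde P_\theta^{(n),\boldsymbol w}$, the modified prior $d\tilde\Pi_{\boldsymbol w}(\theta)=C_{\theta,\boldsymbol w}\,d\Pi_n(\theta)/\int_\Theta C_{\eta,\boldsymbol w}\,d\Pi_n(\eta)$, and the measures $dQ_\theta^{(n),\boldsymbol w}=\big(p_{\theta_0}^{(n)}/\tilde p_{\theta_0}^{(n),\boldsymbol w}\big)\,d\tilde P_\theta^{(n),\boldsymbol w}$, where $p_{\theta_0}^{(n)}=\prod_{i=1}^n p_{\theta_0}(X_i)$. For all sufficiently large $n$ and all $\boldsymbol w\in R_n(c_0)$ these objects are assumed well defined: $0<C_{\theta,\boldsymbol w}<\infty$ for all $\theta\in\Theta$,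 and $\int_\Theta C_{\theta,\boldsymbol w}\,d\Pi_n(\theta)<\infty$. Let $B(\epsilon,\boldsymbol w)$ be the set of $\theta\in\Theta$ for which $\log(\tilde p_{\theta_0}^{(n),\boldsymbol w}/\tilde p_{\theta}^{(n),\boldsymbol w})$ has mean at most $n\epsilon^2$ and variance at most $n\epsilon^2$ under $P_{\theta_0}^{(n)}$. Assumptions. Let $c_0>0$ and let $\epsilon_n>0$ satisfy $\epsilon_n\to0$, $n\epsilon_n^2\to\infty$, and suppose: 1. $P_{\boldsymbol w}[\boldsymbol w_n\in R_n(c_0)]\to1$. 2. The ratio $p_\theta(X_1)/p_{\theta_0}(X_1)$ is almost surely constant under $P_{\theta_0}$ only if $\theta=\theta_0$. 3. (Semi-metric) For each $n$ there is a semi-metric $d=d_n$ (nonnegative, symmetric, zero on the diagonal) on the probability measures on $\mathcal X^n$, and there is a constant $C>0$, such that for all sufficiently large $n$ and all $\boldsymbol w\in R_n(c_0)$, $d(\tilde P_\theta^{(n),\boldsymbol w},\tilde P_{\theta_0}^{(n),\boldsymbol w})\ge C\|\theta-\theta_0\|$ for all $\theta\in\Theta$, with $\|\cdot\|$ the Euclidean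 norm. 4. (Tests) There is a constant $K>0$ such that for all sufficiently large $n$ and every $\epsilon>\epsilon_n$ there is a test $\phi:\mathcal X^n\to[0,1]$ (depending on $n$ and $\epsilon$) with $P_{\theta_0}^{(n)}\phi\le Ke^{-n\epsilon^2/4}$ and, for every integer $J\ge0$, $Q_\theta^{(n),\boldsymbol w}(1-\phi)\le e^{-nJ^2\epsilon^2/4}$ for all $\boldsymbol w\in R_n(c_0)$ and all $\theta$ with $d(\tilde P_\theta^{(n),\boldsymbol w},\tilde P_{\theta_0}^{(n),\boldsymbol w})>J\epsilon$. 5. (Prior mass) There is a constant $L>0$ such that for all sufficiently large $n$ and $j$, $$\sup_{\boldsymbol w\in R_n(c_0)}\frac{\tilde\Pi_{\boldsymbol w}\big(\theta\in\Theta: j\epsilon_n<d(\tilde P_\theta^{(n),\boldsymbol w},\tilde P_{\theta_0}^{(n),\boldsymbol w})\le(j+1)\epsilon_n\big)}{\tilde\Pi_{\boldsymbol w}\big(B(\epsilon_n,\boldsymbol w)\big)}\le L\,e^{n\epsilon_n^2j^2/8}.$$ Conclusion. For every sequence $M_n\to\infty$, $$P_{\theta_0}^{(n)}P_{\boldsymbol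 w}\Big[\Pi_{\boldsymbol w}\big(\|\theta-\theta_0\|>M_n\epsilon_n\mid X^{(n)}\big)\Big]\to0\qquad(n\to\infty).$$ -/

import Mathlib

open MeasureTheory ProbabilityTheory Filter Topology
open scoped ENNReal NNReal

noncomputable section

namespace WeightedPosterior

/-- The weight set `R_n(c₀)`: nonnegative vectors in `ℝⁿ` which sum to `n` and whose largest entry
is at most `c₀ log n`. -/
def weightSet (n : ℕ) (c₀ : ℝ) : Set (Fin n → ℝ) :=
  {a | (∀ i, 0 ≤ a i) ∧ ∑ i, a i = (n : ℝ) ∧ ∀ i, a i ≤ c₀ * Real.log n}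

/-- Nonnegativity, vanishing on the diagonal and symmetry on `S`. The triangle inequality and
separation of points are not required, so every metric and every pseudometric qualifies. -/
structure IsSemimetricOn {M : Type*} (S : Set M) (d : M → M → ℝ) : Prop where
  nonneg : ∀ P ∈ S, ∀ Q ∈ S, 0 ≤ d P Q
  self : ∀ P ∈ S, d P P = 0
  symm : ∀ P ∈ S, ∀ Q ∈ S, d P Q = d Q P

section Model

variable {T X : Type*} [MeasurableSpace T] [MeasurableSpace X]

/-- The law `P_θ` of one observation, with density `p_θ` with respect to `μ`. -/
def obsLaw (μ : Measure X) (p : T → X → ℝ≥0) (θ : T) : Measure X :=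
  μ.withDensity fun x => (p θ x : ℝ≥0∞)

/-- The law `P_θ^{(n)}` of `n` i.i.d. observations. -/
def sampleLaw (μ : Measure X) (p : T → X → ℝ≥0) (n : ℕ) (θ : T) : Measure (Fin n → X) :=
  Measure.pi fun _ => obsLaw μ p θ

/-- The likelihood `p_θ^{(n)}(x) = ∏ i, p_θ(x_i)`. -/
def lik (p : T → X → ℝ≥0) {n : ℕ} (θ : T) (x : Fin n → X) : ℝ≥0∞ :=
  ∏ i, (p θ (x i) : ℝ≥0∞)

/-- The weighted likelihood `p_θ^{(n),w}(x) = ∏ i, p_θ(x_i) ^ w_i`. -/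
def weightedLik (p : T → X → ℝ≥0) {n : ℕ} (w : Fin n → ℝ) (θ : T) (x : Fin n → X) : ℝ≥0∞ :=
  ∏ i, (p θ (x i) : ℝ≥0∞) ^ (w i)

/-- The weighted posterior `Π_w(· | x)`, proportional to `p_θ^{(n),w}(x) Π(dθ)`. -/
def weightedPosterior (p : T → X → ℝ≥0) (prior : Measure T) {n : ℕ} (w : Fin n → ℝ) (x : Fin n → X) :
    Measure T :=
  (∫⁻ θ, weightedLik p w θ x ∂prior)⁻¹ • prior.withDensity fun θ => weightedLik p w θ x

/-- The tilted likelihood `exp(u_{θ,w}(x)) p_θ^{(n)}(x) = p_θ^{(n),w}(x) p_{θ₀}^{(n),1-w}(x)`. -/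
def tiltedLik (p : T → X → ℝ≥0) (θ₀ : T) {n : ℕ} (w : Fin n → ℝ) (θ : T) (x : Fin n → X) : ℝ≥0∞ :=
  weightedLik p w θ x * weightedLik p (fun i => 1 - w i) θ₀ x

/-- The normalizing constant `C_{θ,w}` of the tilted likelihood. -/
def tiltConst (μ : Measure X) (p : T → X → ℝ≥0) (θ₀ : T) {n : ℕ} (w : Fin n → ℝ) (θ : T) : ℝ≥0∞ :=
  ∫⁻ x, tiltedLik p θ₀ w θ x ∂(Measure.pi fun _ : Fin n => μ)

/-- The density of the misspecified model, `tiltedLik / C_{θ,w}`. -/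
def misDensity (μ : Measure X) (p : T → X → ℝ≥0) (θ₀ : T) {n : ℕ} (w : Fin n → ℝ) (θ : T)
    (x : Fin n → X) : ℝ≥0∞ :=
  tiltedLik p θ₀ w θ x / tiltConst μ p θ₀ w θ

/-- The misspecified model, as a measure on the sample space. -/
def misLaw (μ : Measure X) (p : T → X → ℝ≥0) (θ₀ : T) {n : ℕ} (w : Fin n → ℝ) (θ : T) :
    Measure (Fin n → X) :=
  (Measure.pi fun _ : Fin n => μ).withDensity (misDensity μ p θ₀ w θ)

/-- The modified prior, with density `C_{θ,w} / ∫ C_{θ,w} dΠ` with respect to the prior `Π`. -/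
def modifiedPrior (μ : Measure X) (p : T → X → ℝ≥0) (θ₀ : T) (prior : Measure T) {n : ℕ}
    (w : Fin n → ℝ) : Measure T :=
  prior.withDensity fun θ => tiltConst μ p θ₀ w θ / ∫⁻ η, tiltConst μ p θ₀ w η ∂prior

/-- The measure `Q_θ^{(n),w}`, with density `p_{θ₀}^{(n)} / misDensity_{θ₀}` with respect to the
misspecified model at `θ`. -/
def testLaw (μ : Measure X) (p : T → X → ℝ≥0) (θ₀ : T) {n : ℕ} (w : Fin n → ℝ) (θ : T) :
    Measure (Fin n → X) :=
  (misLaw μ p θ₀ w θ).withDensity fun x => lik p θ₀ x / misDensity μ p θ₀ w θ₀ x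

/-- The log-likelihood ratio `log (misDensity_{θ₀} / misDensity_θ)` of the misspecified model. -/
def misLogRatio (μ : Measure X) (p : T → X → ℝ≥0) (θ₀ : T) {n : ℕ} (w : Fin n → ℝ) (θ : T)
    (x : Fin n → X) : ℝ :=
  Real.log (misDensity μ p θ₀ w θ₀ x / misDensity μ p θ₀ w θ x).toReal

/-- The Kullback-Leibler neighbourhood: the parameters for which the mean `K` and the variance `V`
of the log-likelihood ratio under `P_{θ₀}^{(n)}` are at most `n ε²`. The first two clauses express
that `K` is not `+∞`: the ratio is almost surely finite and its logarithm is integrable (its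
negative part always is). -/
def klNbhd (μ : Measure X) (p : T → X → ℝ≥0) (θ₀ : T) {n : ℕ} (w : Fin n → ℝ) (ε : ℝ) : Set T :=
  {θ | (∀ᵐ x ∂(sampleLaw μ p n θ₀), misDensity μ p θ₀ w θ x ≠ 0) ∧
    Integrable (misLogRatio μ p θ₀ w θ) (sampleLaw μ p n θ₀) ∧
    ∫ x, misLogRatio μ p θ₀ w θ x ∂(sampleLaw μ p n θ₀) ≤ n * ε ^ 2 ∧
    evariance (misLogRatio μ p θ₀ w θ) (sampleLaw μ p n θ₀) ≤ ENNReal.ofReal (n * ε ^ 2)}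

/-- The family `p` is a jointly measurable family of probability densities with respect to `μ`. -/
structure IsDensityFamily (μ : Measure X) (p : T → X → ℝ≥0) : Prop where
  measurable : Measurable (Function.uncurry p)
  lintegral_eq_one : ∀ θ, ∫⁻ x, (p θ x : ℝ≥0∞) ∂μ = 1

/-- For large `n` and all admissible weights the misspecified densities and the modified prior can
be normalized. -/
def Normalizable (μ : Measure X) (p : T → X → ℝ≥0) (θ₀ : T) (prior : ℕ → Measure T) (c₀ : ℝ) :
    Prop :=
  ∀ᶠ n : ℕ in atTop, ∀ w ∈ weightSet n c₀,
    (∀ θ, tiltConst μ p θ₀ w θ ≠ 0 ∧ tiltConst μ p θ₀ w θ ≠ ∞) ∧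
    ∫⁻ θ, tiltConst μ p θ₀ w θ ∂(prior n) ≠ ∞

/-- The likelihood ratio `p_θ / p_{θ₀}` is degenerate under `P_{θ₀}` only for `θ = θ₀`. -/
def DegenerateOnlyAtTruth (μ : Measure X) (p : T → X → ℝ≥0) (θ₀ : T) : Prop :=
  ∀ θ, (∃ c : ℝ≥0, ∀ᵐ x ∂(obsLaw μ p θ₀), p θ x / p θ₀ x = c) → θ = θ₀

/-- Existence of suitable tests. -/
def HasTests (μ : Measure X) (p : T → X → ℝ≥0) (θ₀ : T) (c₀ : ℝ) (ε : ℕ → ℝ)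
    (d : (n : ℕ) → Measure (Fin n → X) → Measure (Fin n → X) → ℝ) : Prop :=
  ∃ K : ℝ, 0 < K ∧ ∀ᶠ n : ℕ in atTop, ∀ e : ℝ, ε n < e →
    ∃ φ : (Fin n → X) → ℝ≥0∞, Measurable φ ∧ (∀ x, φ x ≤ 1) ∧
      ∫⁻ x, φ x ∂(sampleLaw μ p n θ₀) ≤ ENNReal.ofReal (K * Real.exp (-(n * e ^ 2 / 4))) ∧
      ∀ J : ℕ, ∀ w ∈ weightSet n c₀, ∀ θ,
        J * e < d n (misLaw μ p θ₀ w θ) (misLaw μ p θ₀ w θ₀) →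
          ∫⁻ x, (1 - φ x) ∂(testLaw μ p θ₀ w θ) ≤
            ENNReal.ofReal (Real.exp (-(n * (J : ℝ) ^ 2 * e ^ 2 / 4)))

/-- Prior regularization: shells around the truth carry little modified prior mass compared with
the Kullback-Leibler neighbourhood of radius `ε n`. -/
def PriorRegular (μ : Measure X) (p : T → X → ℝ≥0) (θ₀ : T) (prior : ℕ → Measure T) (c₀ : ℝ)
    (ε : ℕ → ℝ) (d : (n : ℕ) → Measure (Fin n → X) → Measure (Fin n → X) → ℝ) : Prop :=
  ∃ L : ℝ, 0 < L ∧ ∃ N : ℕ, ∀ n ≥ N, ∀ j ≥ N, ∀ w ∈ weightSet n c₀,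
    modifiedPrior μ p θ₀ (prior n) w
        {θ | j * ε n < d n (misLaw μ p θ₀ w θ) (misLaw μ p θ₀ w θ₀) ∧
          d n (misLaw μ p θ₀ w θ) (misLaw μ p θ₀ w θ₀) ≤ (j + 1) * ε n} /
      modifiedPrior μ p θ₀ (prior n) w (klNbhd μ p θ₀ w (ε n)) ≤
    ENNReal.ofReal (L * Real.exp (n * ε n ^ 2 * (j : ℝ) ^ 2 / 8))

end Model

/-- The semi-metric dominates the Euclidean distance of the parameters, uniformly in the admissible
weights. -/
def DominatesNorm {k : ℕ} {Θ : Set (EuclideanSpace ℝ (Fin k))} {X : Type*} [MeasurableSpace X]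
    (μ : Measure X) (p : Θ → X → ℝ≥0) (θ₀ : Θ) (c₀ : ℝ)
    (d : (n : ℕ) → Measure (Fin n → X) → Measure (Fin n → X) → ℝ) : Prop :=
  ∃ C : ℝ, 0 < C ∧ ∀ᶠ n : ℕ in atTop, ∀ w ∈ weightSet n c₀, ∀ θ : Θ,
    C * ‖(θ : EuclideanSpace ℝ (Fin k)) - θ₀‖ ≤
      d n (misLaw μ p θ₀ w θ) (misLaw μ p θ₀ w θ₀)

end WeightedPosterior

end

namespace WeightedPosterior

/-! ### Product densities and reweighting identities -/

section Measure

/-! For fixed $w$ the constants $C_{\theta,w}$ cancel between the misspecified densities and the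
modified prior, so the weighted posterior is an ordinary posterior (`weightedPosterior_eq_div`). At
$\theta_0$ the tilt is trivial, $\tilde p_{\theta_0}=p_{\theta_0}^{(n)}$. Hence the posterior is a
quotient of integrals of $R_\theta=\tilde p_\theta/p_{\theta_0}^{(n)}$ over the modified prior, and
integrating against $Q_\theta$ means integrating against $R_\theta$ under $P_{\theta_0}^{(n)}$
(`lintegral_testLaw`).

Let $a=n\epsilon_n^2$. By Chebyshev, each $R_\theta$ with $\theta\in B$ is at least $e^{-2a}$
outside an event of probability $1/a$. Fubini and Markov pass this to the average: the denominator
is at least $e^{-2a}\tilde\Pi_w(B)/2$ outside probability $2/a$ (`measure_setLIntegral_lt_le`). For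
the numerator, Fubini and the tests give shell $i$ the factor $e^{-a\lfloor i/2\rfloor^2}$, while
its prior mass relative to $B$ is at most $Le^{ai^2/8}$. As $i^2/4$ beats $i^2/8$, the sum over
large $i$ also absorbs the $e^{2a}$ from the denominator (`tsum_exp_shell_le`).

These bounds are uniform over $R_n(c_0)$, so averaging over $w$ adds only the vanishing probability
of leaving that set. -/

theorem lintegral_pi_prod_eq_prod {X : Type*} [MeasurableSpace X] {n : ℕ}
    (μ : Fin n → Measure X) [∀ i, SigmaFinite (μ i)] (f : Fin n → X → ℝ≥0∞)
    (hf : ∀ i, Measurable (f i)) :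
    ∫⁻ x, ∏ i, f i (x i) ∂(Measure.pi μ) = ∏ i, ∫⁻ x, f i x ∂(μ i) := by
  induction n with
  | zero => simp
  | succ n ih =>
    have hmp := (measurePreserving_piFinSuccAbove μ 0).symm
    rw [← hmp.lintegral_comp_emb (MeasurableEquiv.measurableEmbedding _), Fin.prod_univ_succ,
      ← ih (fun i => μ i.succ) (fun i => f i.succ) fun i => hf i.succ]
    simp only [Fin.prod_univ_succ, MeasurableEquiv.piFinSuccAbove_symm_apply,
      Fin.insertNthEquiv_zero, Fin.consEquiv_apply, Fin.cons_zero, Fin.cons_succ,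
      Fin.zero_succAbove]
    exact lintegral_prod_mul (hf 0).aemeasurable (Finset.measurable_fun_prod _ fun (i : Fin n) _ =>
      (hf i.succ).comp (measurable_pi_apply i)).aemeasurable

theorem pi_withDensity_eq {X : Type*} [MeasurableSpace X] {n : ℕ}
    (μ : Measure X) [SigmaFinite μ] (f : X → ℝ≥0∞) (hf : Measurable f)
    [SigmaFinite (μ.withDensity f)] :
    (Measure.pi fun _ : Fin n => μ.withDensity f) =
      (Measure.pi fun _ : Fin n => μ).withDensity fun x => ∏ i, f (x i) := by
  refine Measure.pi_eq fun s hs => ?_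
  rw [withDensity_apply _ (MeasurableSet.univ_pi hs), Measure.restrict_pi_pi,
    lintegral_pi_prod_eq_prod _ (fun _ => f) fun _ => hf]
  exact Finset.prod_congr rfl fun i _ => (withDensity_apply _ (hs i)).symm

/-- Both sides integrate $\psi f\,l\,l^{-1}$ against `M`. The factor $l\,l^{-1}$ is never cancelled,
so zeros and infinities of `l` need no separate treatment. -/
theorem lintegral_withDensity_withDensity_div_self {Ω : Type*} [MeasurableSpace Ω] (M : Measure Ω)
    {f l ψ : Ω → ℝ≥0∞} (hf : Measurable f) (hl : Measurable l) (hψ : Measurable ψ) :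
    ∫⁻ x, ψ x ∂((M.withDensity f).withDensity fun x => l x / l x) =
      ∫⁻ x, ψ x * (f x / l x) ∂(M.withDensity l) := by
  have hll : Measurable fun x => l x / l x := hl.div hl
  have hfl : Measurable fun x => ψ x * (f x / l x) := hψ.mul (hf.div hl)
  rw [lintegral_withDensity_eq_lintegral_mul _ hll hψ,
    lintegral_withDensity_eq_lintegral_mul _ hf (hll.mul hψ),
    lintegral_withDensity_eq_lintegral_mul _ hl hfl]
  refine lintegral_congr fun x => ?_
  simp only [Pi.mul_apply, div_eq_mul_inv]
  ring

/-- Reweighting the prior by `C / Z` cancels the normalization of the densities by `C`. -/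
theorem setLIntegral_withDensity_div_cancel {T : Type*} [MeasurableSpace T] (ν : Measure T)
    {C f : T → ℝ≥0∞} (hCm : Measurable C) (hf : Measurable f) (hC : ∀ θ, C θ ≠ 0 ∧ C θ ≠ ∞)
    (V Z l : ℝ≥0∞) {A : Set T} (hA : MeasurableSet A) :
    ∫⁻ θ in A, f θ * V / C θ / l ∂(ν.withDensity fun θ => C θ / Z) =
      (∫⁻ θ in A, f θ ∂ν) * (V * (l⁻¹ * Z⁻¹)) := by
  have hg : Measurable fun θ => f θ * V / C θ / l := ((hf.mul_const V).div hCm).div_const l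
  rw [restrict_withDensity hA, lintegral_withDensity_eq_lintegral_mul _ (hCm.div_const Z) hg,
    ← lintegral_mul_const _ hf]
  refine lintegral_congr fun θ => ?_
  simp only [Pi.mul_apply, div_eq_mul_inv]
  calc C θ * Z⁻¹ * (f θ * V * (C θ)⁻¹ * l⁻¹)
      = C θ * (C θ)⁻¹ * (f θ * (V * (l⁻¹ * Z⁻¹))) := by ring
    _ = f θ * (V * (l⁻¹ * Z⁻¹)) := by rw [ENNReal.mul_inv_cancel (hC θ).1 (hC θ).2, one_mul]

end Measure

/-! ### Evidence lower bound, numerator bound, Chebyshev -/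

section Bayes

variable {Ω T : Type*} [MeasurableSpace Ω] [MeasurableSpace T]

/-- A weighted integral of the likelihood ratio over `B` is rarely small if each ratio in `B` is
rarely small. -/
theorem measure_setLIntegral_lt_le (P : Measure Ω) [SFinite P] (ν : Measure T) [IsFiniteMeasure ν]
    {R : Ω → T → ℝ≥0∞} (hR : Measurable (Function.uncurry R)) {B : Set T}
    (hB0 : ν B ≠ 0) {b δ : ℝ≥0∞} (hδ : ∀ θ ∈ B, P {x | R x θ < b} ≤ δ) :
    P {x | ∫⁻ θ in B, R x θ ∂ν < b * (ν B / 2)} ≤ 2 * δ := by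
  have hBtop : ν B ≠ ∞ := measure_ne_top ν B
  have hU : MeasurableSet {z : Ω × T | R z.1 z.2 < b} := measurableSet_lt hR measurable_const
  have hsec : ∀ x, MeasurableSet {θ | R x θ < b} := fun x => hU.preimage measurable_prodMk_left
  have hg : Measurable fun x => (ν.restrict B) {θ | R x θ < b} := measurable_measure_prodMk_left hU
  have hfub : ∫⁻ x, (ν.restrict B) {θ | R x θ < b} ∂P ≤ δ * ν B := by
    calc ∫⁻ x, (ν.restrict B) {θ | R x θ < b} ∂P
        = (P.prod (ν.restrict B)) {z | R z.1 z.2 < b} := (Measure.prod_apply hU).symm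
      _ = ∫⁻ θ in B, P {x | R x θ < b} ∂ν := Measure.prod_apply_symm hU
      _ ≤ ∫⁻ _ in B, δ ∂ν := setLIntegral_mono measurable_const hδ
      _ = δ * ν B := setLIntegral_const _ _
  have hsub : {x | ∫⁻ θ in B, R x θ ∂ν < b * (ν B / 2)} ⊆
      {x | ν B / 2 ≤ (ν.restrict B) {θ | R x θ < b}} := by
    intro x hx
    simp only [Set.mem_ofPred_eq] at hx ⊢
    by_contra! hlt
    refine hx.not_ge ?_
    -- If the ratios below `b` occupy less than half of `B`, those at least `b` occupy at least
    -- half.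
    have hcompl : ν B / 2 ≤ (ν.restrict B) {θ | b ≤ R x θ} := by
      have h1 : (ν.restrict B) {θ | R x θ < b} + (ν.restrict B) {θ | b ≤ R x θ} = ν B := by
        have := measure_add_measure_compl (μ := ν.restrict B) (hsec x)
        rw [Measure.restrict_apply_univ] at this
        rw [← this]
        congr 2
        ext θ
        simp
      by_contra! h2
      have := ENNReal.add_lt_add hlt h2
      rw [h1, ENNReal.add_halves] at this
      exact this.false
    calc b * (ν B / 2) ≤ b * (ν.restrict B) {θ | b ≤ R x θ} := by gcongr
      _ ≤ ∫⁻ θ in B, R x θ ∂ν :=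
        mul_meas_ge_le_lintegral (hR.comp measurable_prodMk_left) b
  have hmarkov := (mul_meas_ge_le_lintegral (μ := P) hg (ν B / 2)).trans hfub
  refine (measure_mono hsub).trans ?_
  have h2 : ν B * P {x | ν B / 2 ≤ (ν.restrict B) {θ | R x θ < b}} ≤ ν B * (2 * δ) := by
    calc ν B * P {x | ν B / 2 ≤ (ν.restrict B) {θ | R x θ < b}}
        = 2 * (ν B / 2 * P {x | ν B / 2 ≤ (ν.restrict B) {θ | R x θ < b}}) := by
          rw [← mul_assoc, ENNReal.mul_div_cancel two_ne_zero ENNReal.ofNat_ne_top]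
      _ ≤ 2 * (δ * ν B) := by gcongr
      _ = ν B * (2 * δ) := by ring
  exact (ENNReal.mul_le_mul_iff_right hB0 hBtop).1 h2

/-- Fubini bound for the part of the likelihood ratio which a test rejects, over a countable cover
by possibly nonmeasurable sets. -/
theorem lintegral_mul_setLIntegral_le_tsum (P : Measure Ω) [SFinite P] (ν : Measure T) [SFinite ν]
    {R : Ω → T → ℝ≥0∞} (hR : Measurable (Function.uncurry R)) {ψ : Ω → ℝ≥0∞} (hψ : Measurable ψ)
    {A : Set T} {S : ℕ → Set T} (hA : A ⊆ ⋃ j, S j) {η : ℕ → ℝ≥0∞}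
    (hη : ∀ j, ∀ θ ∈ S j, ∫⁻ x, ψ x * R x θ ∂P ≤ η j) :
    ∫⁻ x, ψ x * ∫⁻ θ in A, R x θ ∂ν ∂P ≤ ∑' j, η j * ν (S j) := by
  have hm : Measurable (Function.uncurry fun x θ => ψ x * R x θ) :=
    (hψ.comp measurable_fst).mul hR
  have hm' : Measurable fun θ => ∫⁻ x, ψ x * R x θ ∂P := hm.lintegral_prod_left'
  calc ∫⁻ x, ψ x * ∫⁻ θ in A, R x θ ∂ν ∂P
      = ∫⁻ x, ∫⁻ θ in A, ψ x * R x θ ∂ν ∂P :=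
        lintegral_congr fun x => (lintegral_const_mul _ (hR.comp measurable_prodMk_left)).symm
    _ = ∫⁻ θ in A, ∫⁻ x, ψ x * R x θ ∂P ∂ν := lintegral_lintegral_swap hm.aemeasurable
    _ ≤ ∫⁻ θ in ⋃ j, S j, ∫⁻ x, ψ x * R x θ ∂P ∂ν := lintegral_mono_set hA
    _ ≤ ∑' j, ∫⁻ θ in S j, ∫⁻ x, ψ x * R x θ ∂P ∂ν := lintegral_iUnion_le _ _
    _ ≤ ∑' j, η j * ν (S j) := by
      refine ENNReal.tsum_le_tsum fun j => ?_
      rw [← setLIntegral_const]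
      -- What has to be measurable here is the sublevel set of the mean, not `S j`.
      exact lintegral_mono_ae <|
        (ae_restrict_iff (measurableSet_le hm' measurable_const)).2 (.of_forall (hη j))

/-- The mean of a normalized quantity `N / D` is controlled by a test, the probability that the
normalizer is below `c`, and the mean of the numerator on the acceptance region. -/
theorem lintegral_div_le (P : Measure Ω) {N D φ : Ω → ℝ≥0∞} (hN : Measurable N) (hD : Measurable D)
    (hφ : Measurable φ) (hND : ∀ x, N x ≤ D x) (hφ1 : ∀ x, φ x ≤ 1) (c : ℝ≥0∞) :
    ∫⁻ x, N x / D x ∂P ≤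
      ∫⁻ x, φ x ∂P + P {x | D x < c} + (∫⁻ x, (1 - φ x) * N x ∂P) / c := by
  have hbad : MeasurableSet {x | D x < c} := measurableSet_lt hD measurable_const
  calc ∫⁻ x, N x / D x ∂P
      ≤ ∫⁻ x, φ x + {x | D x < c}.indicator 1 x + (1 - φ x) * N x * c⁻¹ ∂P := by
        refine lintegral_mono fun x => ?_
        have h1 : N x / D x ≤ 1 := ENNReal.div_le_of_le_mul (by simpa using hND x)
        by_cases hx : D x < c
        · simp only [Set.indicator_of_mem (show x ∈ {x | D x < c} from hx), Pi.one_apply]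
          exact h1.trans (le_add_right le_add_self)
        · simp only [Set.indicator_of_notMem (show x ∉ {x | D x < c} from hx), add_zero]
          have h2 : N x / D x ≤ N x * c⁻¹ := by
            rw [div_eq_mul_inv]
            gcongr
            exact not_lt.1 hx
          calc N x / D x = φ x * (N x / D x) + (1 - φ x) * (N x / D x) := by
                rw [← add_mul, add_tsub_cancel_of_le (hφ1 x), one_mul]
            _ ≤ φ x * 1 + (1 - φ x) * (N x * c⁻¹) := by gcongr
            _ = _ := by rw [mul_one, mul_assoc]
    _ = _ := by
      have hm : Measurable fun x => (1 - φ x) * N x := (measurable_const.sub hφ).mul hN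
      rw [lintegral_add_right _ (hm.mul_const _), lintegral_add_left hφ,
        lintegral_indicator_one hbad, lintegral_mul_const _ hm, div_eq_mul_inv]

/-- Chebyshev's inequality for a likelihood ratio, in terms of its log-inverse. -/
theorem measure_lt_exp_le (P : Measure Ω) {f : Ω → ℝ≥0∞} {L : Ω → ℝ} (hL : AEStronglyMeasurable L P)
    (hf : ∀ᵐ x ∂P, f x = ENNReal.ofReal (Real.exp (-L x))) {a : ℝ} (ha : 0 < a)
    (hmean : ∫ x, L x ∂P ≤ a) (hvar : evariance L P ≤ ENNReal.ofReal a) :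
    P {x | f x < ENNReal.ofReal (Real.exp (-(2 * a)))} ≤ ENNReal.ofReal a⁻¹ := by
  lift a to ℝ≥0 using ha.le
  have ha' : a ≠ 0 := by rintro rfl; simp at ha
  calc P {x | f x < ENNReal.ofReal (Real.exp (-(2 * a)))}
      ≤ P {x | (a : ℝ) ≤ |L x - ∫ x, L x ∂P|} := by
        refine measure_mono_ae ?_
        filter_upwards [hf] with x hx hlt
        -- $f<e^{-2a}$ forces $L>2a$; the mean is at most $a$, so $L$ deviates from it by at least
        -- $a$.
        change f x < _ at hlt
        rw [hx, ENNReal.ofReal_lt_ofReal_iff (Real.exp_pos _), Real.exp_lt_exp] at hlt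
        change (a : ℝ) ≤ _
        refine le_trans ?_ (le_abs_self _)
        linarith
    _ ≤ evariance L P / (a : ℝ≥0∞) ^ 2 := meas_ge_le_evariance_div_sq hL ha'
    _ ≤ (a : ℝ≥0∞) / (a : ℝ≥0∞) ^ 2 := by
        gcongr
        simpa using hvar
    _ = ENNReal.ofReal (a : ℝ)⁻¹ := by
        have h0 : (a : ℝ≥0∞) ≠ 0 := by simpa using ha'
        rw [← NNReal.coe_inv, ENNReal.ofReal_coe_nnreal, ENNReal.coe_inv ha', sq,
          div_eq_mul_inv, ENNReal.mul_inv (.inl h0) (.inl ENNReal.coe_ne_top), ← mul_assoc,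
          ENNReal.mul_inv_cancel h0 ENNReal.coe_ne_top, one_mul]

end Bayes

/-! ### Pointwise behaviour of the tilted likelihood -/

section Likelihood

variable {T X : Type*} {p : T → X → ℝ≥0} {n : ℕ}

theorem lik_ne_top (θ : T) (x : Fin n → X) : lik p θ x ≠ ∞ :=
  ENNReal.prod_ne_top fun _ _ => ENNReal.coe_ne_top

/-- Where the density is positive the exponents add up to 1. Where it vanishes at some $x_i$,
nonnegativity of $w_i$ makes one product zero: the first if $w_i>0$, the second if $w_i=0$. A
possible infinity in the other is harmless, since $0\cdot\infty=0$. -/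
theorem tiltedLik_self (θ₀ : T) {w : Fin n → ℝ} (hw : ∀ i, 0 ≤ w i) (x : Fin n → X) :
    tiltedLik p θ₀ w θ₀ x = lik p θ₀ x := by
  unfold tiltedLik weightedLik lik
  by_cases h : ∃ i, p θ₀ (x i) = 0
  · obtain ⟨i, hi⟩ := h
    rw [Finset.prod_eq_zero (f := fun i => (p θ₀ (x i) : ℝ≥0∞)) (Finset.mem_univ i) (by simp [hi])]
    rcases (hw i).eq_or_lt with h0 | h0
    · rw [mul_eq_zero]
      exact .inr (Finset.prod_eq_zero (Finset.mem_univ i) (by simp [hi, ← h0]))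
    · rw [mul_eq_zero]
      exact .inl (Finset.prod_eq_zero (Finset.mem_univ i) (by simp [hi, h0]))
  · push Not at h
    rw [← Finset.prod_mul_distrib]
    refine Finset.prod_congr rfl fun i _ => ?_
    rw [← ENNReal.rpow_add _ _ (by simpa using h i) ENNReal.coe_ne_top]
    simp

theorem weightedLik_ne_zero_ne_top {θ : T} {x : Fin n → X} (hx : lik p θ x ≠ 0) (v : Fin n → ℝ) :
    weightedLik p v θ x ≠ 0 ∧ weightedLik p v θ x ≠ ∞ := by
  have h : ∀ i, (p θ (x i) : ℝ≥0∞) ≠ 0 := fun i => Finset.prod_ne_zero_iff.1 hx i (Finset.mem_univ i)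
  exact ⟨Finset.prod_ne_zero_iff.2 fun i _ => by simp [ENNReal.rpow_eq_zero_iff, h i],
    ENNReal.prod_ne_top fun i _ => by
      simp only [ne_eq, ENNReal.rpow_eq_top_iff, h i, ENNReal.coe_ne_top, false_and, or_self,
        not_false_eq_true]⟩

end Likelihood

/-! ### The weighted posterior as a quotient -/

section WeightedPosterior

variable {T X : Type*} [MeasurableSpace T] {p : T → X → ℝ≥0} {n : ℕ}

theorem weightedPosterior_apply (prior : Measure T) (w : Fin n → ℝ) (x : Fin n → X) {A : Set T}
    (hA : MeasurableSet A) :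
    weightedPosterior p prior w x A =
      (∫⁻ θ in A, weightedLik p w θ x ∂prior) / ∫⁻ θ, weightedLik p w θ x ∂prior := by
  rw [weightedPosterior, Measure.smul_apply, withDensity_apply _ hA, smul_eq_mul, mul_comm,
    div_eq_mul_inv]

theorem weightedPosterior_le_one (prior : Measure T) (w : Fin n → ℝ) (x : Fin n → X) {A : Set T}
    (hA : MeasurableSet A) : weightedPosterior p prior w x A ≤ 1 := by
  rw [weightedPosterior_apply prior w x hA]
  exact ENNReal.div_le_of_le_mul (by simpa using setLIntegral_le_lintegral A _)

end WeightedPosterior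

/-! ### The misspecified model under the true law -/

section Model

variable {T X : Type*} [MeasurableSpace T] [MeasurableSpace X]
variable {μ : Measure X} {p : T → X → ℝ≥0} {n : ℕ}

theorem IsDensityFamily.measurable_weightedLik (hp : IsDensityFamily μ p) :
    Measurable fun z : (Fin n → ℝ) × T × (Fin n → X) => weightedLik p z.1 z.2.1 z.2.2 := by
  refine Finset.measurable_fun_prod _ fun i _ => ?_
  refine Measurable.pow (f := fun z : (Fin n → ℝ) × T × (Fin n → X) => (p z.2.1 (z.2.2 i) : ℝ≥0∞))
    ?_ ((measurable_pi_apply i).comp measurable_fst)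
  exact (hp.measurable.comp (measurable_snd.fst.prodMk
    ((measurable_pi_apply i).comp measurable_snd.snd))).coe_nnreal_ennreal

theorem IsDensityFamily.measurable_lik (hp : IsDensityFamily μ p) (θ : T) :
    Measurable fun x : Fin n → X => lik p θ x :=
  Finset.measurable_fun_prod _ fun i _ => ((hp.measurable.comp measurable_prodMk_left).comp
    (measurable_pi_apply i)).coe_nnreal_ennreal

theorem IsDensityFamily.measurable_tiltedLik (hp : IsDensityFamily μ p) (θ₀ : T) (w : Fin n → ℝ) :
    Measurable fun z : T × (Fin n → X) => tiltedLik p θ₀ w z.1 z.2 :=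
  (hp.measurable_weightedLik.comp (measurable_const.prodMk measurable_id)).mul
    (hp.measurable_weightedLik.comp
      (measurable_const.prodMk (measurable_const.prodMk measurable_snd)))

theorem IsDensityFamily.measurable_tiltConst [SigmaFinite μ] (hp : IsDensityFamily μ p) (θ₀ : T)
    (w : Fin n → ℝ) : Measurable fun θ => tiltConst μ p θ₀ w θ :=
  (hp.measurable_tiltedLik θ₀ w).lintegral_prod_right'

theorem IsDensityFamily.measurable_misDensity [SigmaFinite μ] (hp : IsDensityFamily μ p) (θ₀ : T)
    (w : Fin n → ℝ) : Measurable fun z : T × (Fin n → X) => misDensity μ p θ₀ w z.1 z.2 :=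
  (hp.measurable_tiltedLik θ₀ w).div ((hp.measurable_tiltConst θ₀ w).comp measurable_fst)

theorem IsDensityFamily.isProbabilityMeasure_obsLaw (hp : IsDensityFamily μ p) (θ : T) :
    IsProbabilityMeasure (obsLaw μ p θ) :=
  ⟨by rw [obsLaw, withDensity_apply _ .univ, setLIntegral_univ, hp.lintegral_eq_one θ]⟩

theorem IsDensityFamily.isProbabilityMeasure_sampleLaw (hp : IsDensityFamily μ p) (θ : T) :
    IsProbabilityMeasure (sampleLaw μ p n θ) := by
  have := hp.isProbabilityMeasure_obsLaw θ
  unfold sampleLaw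
  infer_instance

theorem IsDensityFamily.sampleLaw_eq_withDensity [SigmaFinite μ] (hp : IsDensityFamily μ p)
    (θ : T) :
    sampleLaw μ p n θ = (Measure.pi fun _ : Fin n => μ).withDensity (lik p θ) := by
  have := hp.isProbabilityMeasure_obsLaw θ
  unfold obsLaw at this
  exact pi_withDensity_eq μ _ (hp.measurable.comp measurable_prodMk_left).coe_nnreal_ennreal

theorem IsDensityFamily.ae_lik_ne_zero [SigmaFinite μ] (hp : IsDensityFamily μ p) (θ : T) :
    ∀ᵐ x ∂(sampleLaw μ p n θ), lik p θ x ≠ 0 := by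
  rw [hp.sampleLaw_eq_withDensity, ae_withDensity_iff (hp.measurable_lik θ)]
  exact .of_forall fun _ h => h

theorem IsDensityFamily.tiltConst_self [SigmaFinite μ] (hp : IsDensityFamily μ p) (θ₀ : T)
    {w : Fin n → ℝ} (hw : ∀ i, 0 ≤ w i) : tiltConst μ p θ₀ w θ₀ = 1 := by
  have := hp.isProbabilityMeasure_sampleLaw (n := n) θ₀
  have h := measure_univ (μ := sampleLaw μ p n θ₀)
  rw [hp.sampleLaw_eq_withDensity, withDensity_apply _ .univ, setLIntegral_univ] at h
  simpa only [tiltConst, tiltedLik_self θ₀ hw] using h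

theorem IsDensityFamily.misDensity_self [SigmaFinite μ] (hp : IsDensityFamily μ p) (θ₀ : T)
    {w : Fin n → ℝ} (hw : ∀ i, 0 ≤ w i) (x : Fin n → X) :
    misDensity μ p θ₀ w θ₀ x = lik p θ₀ x := by
  rw [misDensity, tiltedLik_self θ₀ hw, hp.tiltConst_self θ₀ hw, div_one]

theorem IsDensityFamily.ae_misDensity_ne_top [SigmaFinite μ] (hp : IsDensityFamily μ p) (θ₀ : T)
    {w : Fin n → ℝ} {θ : T} (h0 : tiltConst μ p θ₀ w θ ≠ 0) (htop : tiltConst μ p θ₀ w θ ≠ ∞) :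
    ∀ᵐ x ∂(sampleLaw μ p n θ₀), misDensity μ p θ₀ w θ x ≠ ∞ := by
  rw [hp.sampleLaw_eq_withDensity]
  refine (withDensity_absolutelyContinuous _ _).ae_le ?_
  filter_upwards [ae_lt_top ((hp.measurable_tiltedLik θ₀ w).comp measurable_prodMk_left) htop]
    with x hx
  exact ENNReal.div_ne_top hx.ne h0

/-- Since $\tilde p_{\theta_0}=p_{\theta_0}^{(n)}$, this turns the type II errors of the tests into
means of the posterior numerator. -/
theorem IsDensityFamily.lintegral_testLaw [SigmaFinite μ] (hp : IsDensityFamily μ p) (θ₀ : T)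
    {w : Fin n → ℝ} (hw : ∀ i, 0 ≤ w i) (θ : T) {ψ : (Fin n → X) → ℝ≥0∞} (hψ : Measurable ψ) :
    ∫⁻ x, ψ x ∂(testLaw μ p θ₀ w θ) =
      ∫⁻ x, ψ x * (misDensity μ p θ₀ w θ x / lik p θ₀ x) ∂(sampleLaw μ p n θ₀) := by
  have hm : Measurable (misDensity μ p θ₀ w θ) := by
    have h := hp.measurable_misDensity θ₀ w
    have h2 := h.comp (measurable_const (a := θ) |>.prodMk measurable_id)
    simp only [Function.comp_def, id] at h2
    exact h2
  unfold testLaw misLaw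
  simp only [hp.misDensity_self θ₀ hw]
  rw [hp.sampleLaw_eq_withDensity]
  exact lintegral_withDensity_withDensity_div_self (Measure.pi fun _ : Fin n => μ) hm
    (hp.measurable_lik θ₀) hψ

theorem IsDensityFamily.measure_misDensity_div_lt_le [SigmaFinite μ] (hp : IsDensityFamily μ p)
    (θ₀ : T) {w : Fin n → ℝ} (hw : ∀ i, 0 ≤ w i) {θ : T} (h0 : tiltConst μ p θ₀ w θ ≠ 0)
    (htop : tiltConst μ p θ₀ w θ ≠ ∞) {e : ℝ} (ha : 0 < n * e ^ 2) (hθ : θ ∈ klNbhd μ p θ₀ w e) :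
    sampleLaw μ p n θ₀ {x | misDensity μ p θ₀ w θ x / lik p θ₀ x <
      ENNReal.ofReal (Real.exp (-(2 * (n * e ^ 2))))} ≤ ENNReal.ofReal (n * e ^ 2)⁻¹ := by
  obtain ⟨hne, hint, hmean, hvar⟩ := hθ
  refine measure_lt_exp_le _ hint.aestronglyMeasurable ?_ ha hmean hvar
  filter_upwards [hne, hp.ae_misDensity_ne_top θ₀ h0 htop, hp.ae_lik_ne_zero θ₀] with x h1 h2 h3
  have htop' : lik p θ₀ x / misDensity μ p θ₀ w θ x ≠ ∞ := ENNReal.div_ne_top (lik_ne_top _ _) h1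
  have hpos := ENNReal.toReal_pos (ENNReal.div_ne_zero.2 ⟨h3, h2⟩) htop'
  rw [misLogRatio, hp.misDensity_self θ₀ hw, Real.exp_neg, Real.exp_log hpos,
    ENNReal.ofReal_inv_of_pos hpos, ENNReal.ofReal_toReal htop',
    ENNReal.inv_div (.inl h2) (.inl h1)]

/-- Integrals of the weighted likelihood with respect to the prior are, up to a factor which does
not depend on the parameter, integrals of a likelihood ratio with respect to the modified prior. -/
theorem IsDensityFamily.setLIntegral_misDensity_div [SigmaFinite μ] (hp : IsDensityFamily μ p)
    (θ₀ : T) (prior : Measure T) {w : Fin n → ℝ}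
    (hC : ∀ θ, tiltConst μ p θ₀ w θ ≠ 0 ∧ tiltConst μ p θ₀ w θ ≠ ∞) (x : Fin n → X) {A : Set T}
    (hA : MeasurableSet A) :
    ∫⁻ θ in A, misDensity μ p θ₀ w θ x / lik p θ₀ x ∂(modifiedPrior μ p θ₀ prior w) =
      (∫⁻ θ in A, weightedLik p w θ x ∂prior) *
        (weightedLik p (fun i => 1 - w i) θ₀ x * ((lik p θ₀ x)⁻¹ *
          (∫⁻ η, tiltConst μ p θ₀ w η ∂prior)⁻¹)) := by
  have hwl : Measurable fun θ => weightedLik p w θ x :=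
    hp.measurable_weightedLik.comp (measurable_const.prodMk measurable_prodMk_right)
  exact setLIntegral_withDensity_div_cancel prior (hp.measurable_tiltConst θ₀ w) hwl hC _ _ _ hA

end Model

/-! ### Posterior representation and nonasymptotic bound -/

section Posterior

variable {T X : Type*} [MeasurableSpace T] [MeasurableSpace X]
variable {μ : Measure X} {p : T → X → ℝ≥0} {n : ℕ}

theorem IsDensityFamily.measurable_weightedPosterior (hp : IsDensityFamily μ p)
    (prior : Measure T) [SFinite prior] {A : Set T} (hA : MeasurableSet A) :
    Measurable fun z : (Fin n → X) × (Fin n → ℝ) => weightedPosterior p prior z.2 z.1 A := by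
  simp only [weightedPosterior_apply prior _ _ hA]
  have h : Measurable fun y : ((Fin n → X) × (Fin n → ℝ)) × T => weightedLik p y.1.2 y.2 y.1.1 :=
    hp.measurable_weightedLik.comp
      (measurable_fst.snd.prodMk (measurable_snd.prodMk measurable_fst.fst))
  exact h.lintegral_prod_right'.div h.lintegral_prod_right'

theorem isFiniteMeasure_modifiedPrior (θ₀ : T) (prior : Measure T) (w : Fin n → ℝ)
    (hm : Measurable fun θ => tiltConst μ p θ₀ w θ) :
    IsFiniteMeasure (modifiedPrior μ p θ₀ prior w) := by
  refine isFiniteMeasure_withDensity (ne_top_of_le_ne_top ENNReal.one_ne_top ?_)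
  simp only [div_eq_mul_inv]
  rw [lintegral_mul_const _ hm]
  exact ENNReal.mul_inv_le_one _

/-- The weighted posterior is the ordinary posterior of the misspecified model with the modified
prior. -/
theorem IsDensityFamily.weightedPosterior_eq_div [SigmaFinite μ] (hp : IsDensityFamily μ p)
    (θ₀ : T) (prior : Measure T) [IsProbabilityMeasure prior] {w : Fin n → ℝ}
    (hC : ∀ θ, tiltConst μ p θ₀ w θ ≠ 0 ∧ tiltConst μ p θ₀ w θ ≠ ∞)
    (hZ : ∫⁻ θ, tiltConst μ p θ₀ w θ ∂prior ≠ ∞) {x : Fin n → X} (hx : lik p θ₀ x ≠ 0)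
    {A : Set T} (hA : MeasurableSet A) :
    weightedPosterior p prior w x A =
      (∫⁻ θ in A, misDensity μ p θ₀ w θ x / lik p θ₀ x ∂(modifiedPrior μ p θ₀ prior w)) /
        ∫⁻ θ, misDensity μ p θ₀ w θ x / lik p θ₀ x ∂(modifiedPrior μ p θ₀ prior w) := by
  have hZ0 : ∫⁻ θ, tiltConst μ p θ₀ w θ ∂prior ≠ 0 := by
    rw [ne_eq, lintegral_eq_zero_iff (hp.measurable_tiltConst θ₀ w)]
    intro h
    obtain ⟨θ, hθ⟩ := h.exists
    exact (hC θ).1 hθ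
  obtain ⟨hV0, hVtop⟩ := weightedLik_ne_zero_ne_top hx fun i => 1 - w i
  have hl := hp.setLIntegral_misDensity_div θ₀ prior hC x .univ
  rw [setLIntegral_univ, setLIntegral_univ] at hl
  rw [weightedPosterior_apply prior w x hA, hl, hp.setLIntegral_misDensity_div θ₀ prior hC x hA,
    ENNReal.mul_div_mul_right]
  · exact mul_ne_zero hV0 (mul_ne_zero (ENNReal.inv_ne_zero.2 (lik_ne_top _ _))
      (ENNReal.inv_ne_zero.2 hZ))
  · exact ENNReal.mul_ne_top hVtop (ENNReal.mul_ne_top (ENNReal.inv_ne_top.2 hx)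
      (ENNReal.inv_ne_top.2 hZ0))

/-- Nonasymptotic bound on the mean weighted posterior mass of a set covered by shells `S j`, in
terms of a test and the modified prior mass of the shells. -/
theorem IsDensityFamily.lintegral_weightedPosterior_le [SigmaFinite μ] (hp : IsDensityFamily μ p)
    (θ₀ : T) (prior : Measure T) [IsProbabilityMeasure prior] {w : Fin n → ℝ} (hw : ∀ i, 0 ≤ w i)
    (hC : ∀ θ, tiltConst μ p θ₀ w θ ≠ 0 ∧ tiltConst μ p θ₀ w θ ≠ ∞)
    (hZ : ∫⁻ θ, tiltConst μ p θ₀ w θ ∂prior ≠ ∞) {e : ℝ} (he : 0 < n * e ^ 2)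
    {φ : (Fin n → X) → ℝ≥0∞} (hφ : Measurable φ) (hφ1 : ∀ x, φ x ≤ 1)
    {A : Set T} (hA : MeasurableSet A) {S : ℕ → Set T} (hAS : A ⊆ ⋃ j, S j) {η ρ : ℕ → ℝ≥0∞}
    (hη : ∀ j, ∀ θ ∈ S j, ∫⁻ x, (1 - φ x) ∂(testLaw μ p θ₀ w θ) ≤ η j) (hρtop : ∀ j, ρ j ≠ ∞)
    (hρ : ∀ j, modifiedPrior μ p θ₀ prior w (S j) /
      modifiedPrior μ p θ₀ prior w (klNbhd μ p θ₀ w e) ≤ ρ j) :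
    ∫⁻ x, weightedPosterior p prior w x A ∂(sampleLaw μ p n θ₀) ≤
      ∫⁻ x, φ x ∂(sampleLaw μ p n θ₀) + 2 * ENNReal.ofReal (n * e ^ 2)⁻¹ +
        2 * ENNReal.ofReal (Real.exp (2 * (n * e ^ 2))) * ∑' j, η j * ρ j := by
  have := hp.isProbabilityMeasure_sampleLaw (n := n) θ₀
  have := isFiniteMeasure_modifiedPrior θ₀ prior w (hp.measurable_tiltConst θ₀ w)
  set P := sampleLaw μ p n θ₀ with hP
  set ν := modifiedPrior μ p θ₀ prior w with hν
  set B := klNbhd μ p θ₀ w e with hB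
  let R : (Fin n → X) → T → ℝ≥0∞ := fun x θ => misDensity μ p θ₀ w θ x / lik p θ₀ x
  have hR : Measurable (Function.uncurry R) := by
    have h := (hp.measurable_misDensity θ₀ w).comp (measurable_swap (α := Fin n → X) (β := T))
    exact h.div ((hp.measurable_lik θ₀).comp measurable_fst)
  have hpost : ∫⁻ x, weightedPosterior p prior w x A ∂P =
      ∫⁻ x, (∫⁻ θ in A, R x θ ∂ν) / ∫⁻ θ, R x θ ∂ν ∂P := by
    refine lintegral_congr_ae ?_
    filter_upwards [hp.ae_lik_ne_zero θ₀] with x hx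
    exact hp.weightedPosterior_eq_div θ₀ prior hC hZ hx hA
  rw [hpost]
  by_cases hB0 : ν B = 0
  -- A nonnull shell divided by zero would be $\infty$, against the finite bound `ρ j`; so all
  -- shells, and with them `A`, are null.
  · have hS : ∀ j, ν (S j) = 0 := by
      intro j
      by_contra hj
      have h := hρ j
      rw [hB0, ENNReal.div_zero hj] at h
      exact hρtop j (top_le_iff.1 h)
    have hA0 : ν A = 0 := measure_mono_null hAS (measure_iUnion_null hS)
    simp [Measure.restrict_eq_zero.2 hA0]
  have hBtop : ν B ≠ ∞ := measure_ne_top ν B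
  set b : ℝ≥0∞ := ENNReal.ofReal (Real.exp (-(2 * (n * e ^ 2)))) with hb
  refine (lintegral_div_le P hR.lintegral_prod_right' hR.lintegral_prod_right' hφ
    (fun x => setLIntegral_le_lintegral A _) hφ1 (b * (ν B / 2))).trans ?_
  refine add_le_add (add_le_add le_rfl ?_) ?_
  · refine (measure_mono fun x hx => ?_).trans (measure_setLIntegral_lt_le P ν hR hB0 fun θ hθ =>
      hp.measure_misDensity_div_lt_le θ₀ hw (hC θ).1 (hC θ).2 he hθ)
    exact (setLIntegral_le_lintegral B _).trans_lt hx
  · have hnum := lintegral_mul_setLIntegral_le_tsum P ν hR (measurable_const.sub hφ) hAS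
      fun j θ hθ => (hp.lintegral_testLaw θ₀ hw θ (measurable_const.sub hφ)).symm.trans_le (hη j θ hθ)
    have hbinv : b⁻¹ = ENNReal.ofReal (Real.exp (2 * (n * e ^ 2))) := by
      rw [hb, Real.exp_neg, ENNReal.ofReal_inv_of_pos (Real.exp_pos _), inv_inv]
    have hc : (b * (ν B / 2))⁻¹ = 2 * b⁻¹ * (ν B)⁻¹ := by
      rw [ENNReal.mul_inv (.inr (ENNReal.div_ne_top hBtop two_ne_zero))
        (.inl ENNReal.ofReal_ne_top), ENNReal.inv_div (.inl ENNReal.ofNat_ne_top)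
        (.inl two_ne_zero), div_eq_mul_inv]
      ring
    calc (∫⁻ x, (1 - φ x) * ∫⁻ θ in A, R x θ ∂ν ∂P) / (b * (ν B / 2))
        ≤ (∑' j, η j * ν (S j)) / (b * (ν B / 2)) := by gcongr; exact hnum
      _ = 2 * b⁻¹ * ∑' j, η j * (ν (S j) / ν B) := by
        rw [div_eq_mul_inv, hc, mul_comm, mul_assoc, ← ENNReal.tsum_mul_left]
        simp only [div_eq_mul_inv]
        congr 2 with j
        ring
      _ ≤ _ := by
        rw [hbinv]
        gcongr with j
        exact hρ j

end Posterior

/-! ### Summing the shells -/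

section Rate

/-- With $i=m+j$ and $J=\lfloor i/2\rfloor$, it suffices that $J^2-i^2/8\ge j+3$: two units pay for
$e^{-2a}$ and $j+1$ give the geometric factor. This follows from $i\le 2J+1$, $J\ge10$ and $j\le
i-20$. -/
theorem exp_shell_le {a L : ℝ} (ha : 0 ≤ a) (hL : 0 ≤ L) {m : ℕ} (hm : 20 ≤ m) (j : ℕ) :
    Real.exp (-(a * (((m + j) / 2 : ℕ) : ℝ) ^ 2)) *
      (L * Real.exp (a * ((m + j : ℕ) : ℝ) ^ 2 / 8)) ≤
    L * Real.exp (-(2 * a)) * Real.exp (-a) ^ (j + 1) := by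
  rw [← Real.exp_nat_mul, mul_left_comm, ← Real.exp_add, mul_assoc, ← Real.exp_add]
  refine mul_le_mul_of_nonneg_left (Real.exp_le_exp.2 ?_) hL
  set i := m + j with hi
  set J := i / 2 with hJ
  have h1 : (i : ℝ) ≤ 2 * J + 1 := by exact_mod_cast (by omega : i ≤ 2 * J + 1)
  have h2 : (10 : ℝ) ≤ J := by exact_mod_cast (by omega : 10 ≤ J)
  have h3 : (j : ℝ) + 20 ≤ i := by exact_mod_cast (by omega : j + 20 ≤ i)
  have h4 : (i : ℝ) ^ 2 ≤ (2 * J + 1) ^ 2 := by gcongr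
  have h5 : (j : ℝ) + 3 ≤ (J : ℝ) ^ 2 - (i : ℝ) ^ 2 / 8 := by nlinarith
  have h6 := mul_le_mul_of_nonneg_left h5 ha
  push_cast
  linarith

theorem tsum_exp_shell_le {a L : ℝ} (ha : 0 ≤ a) (hL : 0 ≤ L) {m : ℕ} (hm : 20 ≤ m) :
    2 * ENNReal.ofReal (Real.exp (2 * a)) *
      ∑' j : ℕ, ENNReal.ofReal (Real.exp (-(a * (((m + j) / 2 : ℕ) : ℝ) ^ 2))) *
        ENNReal.ofReal (L * Real.exp (a * ((m + j : ℕ) : ℝ) ^ 2 / 8)) ≤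
    2 * ENNReal.ofReal L *
      (ENNReal.ofReal (Real.exp (-a)) * (1 - ENNReal.ofReal (Real.exp (-a)))⁻¹) := by
  set r := ENNReal.ofReal (Real.exp (-a)) with hr
  have hterm : ∀ j : ℕ, ENNReal.ofReal (Real.exp (-(a * (((m + j) / 2 : ℕ) : ℝ) ^ 2))) *
        ENNReal.ofReal (L * Real.exp (a * ((m + j : ℕ) : ℝ) ^ 2 / 8)) ≤
      ENNReal.ofReal L * ENNReal.ofReal (Real.exp (-(2 * a))) * r * r ^ j := by
    intro j
    rw [← ENNReal.ofReal_mul (Real.exp_pos _).le, mul_assoc _ r, ← pow_succ', hr,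
      ← ENNReal.ofReal_pow (Real.exp_pos _).le, ← ENNReal.ofReal_mul hL,
      ← ENNReal.ofReal_mul (mul_nonneg hL (Real.exp_pos _).le)]
    exact ENNReal.ofReal_le_ofReal (exp_shell_le ha hL hm j)
  have hone : ENNReal.ofReal (Real.exp (2 * a)) * ENNReal.ofReal (Real.exp (-(2 * a))) = 1 := by
    rw [← ENNReal.ofReal_mul (Real.exp_pos _).le, ← Real.exp_add]
    simp
  calc _ ≤ 2 * ENNReal.ofReal (Real.exp (2 * a)) *
        ∑' j : ℕ, ENNReal.ofReal L * ENNReal.ofReal (Real.exp (-(2 * a))) * r * r ^ j := by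
          exact mul_le_mul_right (ENNReal.tsum_le_tsum hterm) _
    _ = ENNReal.ofReal (Real.exp (2 * a)) * ENNReal.ofReal (Real.exp (-(2 * a))) *
        (2 * ENNReal.ofReal L * (r * (1 - r)⁻¹)) := by
          rw [ENNReal.tsum_mul_left, ENNReal.tsum_geometric]; ring
    _ = _ := by rw [hone, one_mul]

/-- The bound on the mean posterior mass for exponent `a = n ε²`. -/
noncomputable def contractionBound (K L a : ℝ) : ℝ≥0∞ :=
  ENNReal.ofReal (K * Real.exp (-a)) + 2 * ENNReal.ofReal a⁻¹ +
    2 * ENNReal.ofReal L *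
      (ENNReal.ofReal (Real.exp (-a)) * (1 - ENNReal.ofReal (Real.exp (-a)))⁻¹)

theorem tendsto_contractionBound (K L : ℝ) :
    Tendsto (contractionBound K L) atTop (𝓝 0) := by
  have hexp : Tendsto (fun a : ℝ => Real.exp (-a)) atTop (𝓝 0) :=
    Real.tendsto_exp_neg_atTop_nhds_zero
  have hr : Tendsto (fun a : ℝ => ENNReal.ofReal (Real.exp (-a))) atTop (𝓝 0) := by
    simpa using ENNReal.tendsto_ofReal hexp
  have h1 : Tendsto (fun a : ℝ => ENNReal.ofReal (K * Real.exp (-a))) atTop (𝓝 0) := by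
    simpa using ENNReal.tendsto_ofReal (hexp.const_mul K)
  have h2 : Tendsto (fun a : ℝ => 2 * ENNReal.ofReal a⁻¹) atTop (𝓝 0) := by
    simpa using ENNReal.Tendsto.const_mul (ENNReal.tendsto_ofReal tendsto_inv_atTop_zero)
      (.inr (ENNReal.ofNat_ne_top (n := 2)))
  have h3 : Tendsto (fun a : ℝ => (1 - ENNReal.ofReal (Real.exp (-a)))⁻¹) atTop (𝓝 1) := by
    simpa using tendsto_inv_iff.2
      (ENNReal.Tendsto.sub (tendsto_const_nhds (x := (1 : ℝ≥0∞))) hr (.inl ENNReal.one_ne_top))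
  have h4 := ENNReal.Tendsto.const_mul (ENNReal.Tendsto.mul hr (.inr ENNReal.one_ne_top) h3
    (.inr ENNReal.zero_ne_top))
    (.inr (ENNReal.mul_ne_top (ENNReal.ofNat_ne_top (n := 2)) (ENNReal.ofReal_ne_top (r := L))))
  have h := (h1.add h2).add h4
  simp only [mul_zero, zero_mul, add_zero] at h
  exact h

end Rate

/-! ### Uniform contraction over admissible weights -/

section Contraction

theorem measurableSet_weightSet (n : ℕ) (c₀ : ℝ) : MeasurableSet (weightSet n c₀) := by
  have h : weightSet n c₀ = (⋂ i, {a : Fin n → ℝ | 0 ≤ a i}) ∩ ({a | ∑ i, a i = (n : ℝ)} ∩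
      ⋂ i, {a | a i ≤ c₀ * Real.log n}) := by
    ext a
    simp [weightSet]
  rw [h]
  refine ((isClosed_iInter fun i => isClosed_le continuous_const (continuous_apply i)).inter
    ((isClosed_eq (by fun_prop) continuous_const).inter
      (isClosed_iInter fun i => isClosed_le (continuous_apply i) continuous_const))).measurableSet

/-- Every `t > m ε` lies in one of the shells `(i ε, (i + 1) ε]` with `i ≥ m`. -/
theorem exists_shell {ε t : ℝ} (hε : 0 < ε) {m : ℕ} (ht : m * ε < t) :
    ∃ j : ℕ, ((m + j : ℕ) : ℝ) * ε < t ∧ t ≤ (((m + j : ℕ) : ℝ) + 1) * ε := by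
  have hmt : (m : ℝ) < t / ε := (lt_div_iff₀ hε).2 ht
  have hceil : m + 1 ≤ ⌈t / ε⌉₊ := Nat.lt_ceil.2 hmt
  -- The shell index is $\lceil t/\varepsilon\rceil-1$, as shells are open on the left; `hceil`
  -- makes the truncated subtractions exact.
  refine ⟨⌈t / ε⌉₊ - 1 - m, ?_, ?_⟩
  · rw [← lt_div_iff₀ hε, ← Nat.lt_ceil]
    omega
  · rw [← div_le_iff₀ hε]
    refine (Nat.le_ceil _).trans ?_
    exact_mod_cast (by omega : ⌈t / ε⌉₊ ≤ m + (⌈t / ε⌉₊ - 1 - m) + 1)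

variable {k : ℕ} {Θ : Set (EuclideanSpace ℝ (Fin k))} {X : Type*} [MeasurableSpace X]

/-- Contraction of the weighted posterior, uniformly in the admissible weights. -/
theorem eventually_lintegral_weightedPosterior_le (μ : Measure X) [SigmaFinite μ]
    (p : Θ → X → ℝ≥0) (hp : IsDensityFamily μ p) (θ₀ : Θ)
    (prior : ℕ → Measure Θ) [∀ n, IsProbabilityMeasure (prior n)] (c₀ : ℝ)
    (ε : ℕ → ℝ) (hε_pos : ∀ n, 0 < ε n)
    (hnorm : Normalizable μ p θ₀ prior c₀)
    (d : (n : ℕ) → Measure (Fin n → X) → Measure (Fin n → X) → ℝ)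
    (hmetric : DominatesNorm μ p θ₀ c₀ d) (htest : HasTests μ p θ₀ c₀ ε d)
    (hprior : PriorRegular μ p θ₀ prior c₀ ε d) (M : ℕ → ℝ) (hM : Tendsto M atTop atTop) :
    ∃ K L : ℝ, ∀ᶠ n : ℕ in atTop, ∀ w ∈ weightSet n c₀,
      ∫⁻ x, weightedPosterior p (prior n) w x
        {θ | M n * ε n < ‖(θ : EuclideanSpace ℝ (Fin k)) - θ₀‖} ∂(sampleLaw μ p n θ₀) ≤
      contractionBound K L (n * ε n ^ 2) := by
  obtain ⟨C, hC, hmetric⟩ := hmetric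
  obtain ⟨K, -, htest⟩ := htest
  obtain ⟨L, hL, N, hprior⟩ := hprior
  refine ⟨K, L, ?_⟩
  -- `N` makes the prior condition available on every shell; 20 is the threshold of `exp_shell_le`.
  set m := max N 20 with hm
  filter_upwards [hmetric, htest, hnorm, eventually_ge_atTop N, eventually_gt_atTop 0,
    hM.eventually_ge_atTop (m / C)] with n hmetric htest hnorm hnN hn hMn w hw
  have hεn := hε_pos n
  -- Tests exist only at radii strictly above `ε n`. Doubling the radius cancels the 4 in the
  -- exponents and turns shell index $i$ into $J=\lfloor i/2\rfloor$.
  obtain ⟨φ, hφ, hφ1, hφP, hφQ⟩ := htest (2 * ε n) (by linarith)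
  have ha : 0 < (n : ℝ) * ε n ^ 2 := by positivity
  set D : Θ → ℝ := fun θ => d n (misLaw μ p θ₀ w θ) (misLaw μ p θ₀ w θ₀) with hD
  set S : ℕ → Set Θ := fun j =>
    {θ | ((m + j : ℕ) : ℝ) * ε n < D θ ∧ D θ ≤ (((m + j : ℕ) : ℝ) + 1) * ε n} with hS
  have hA : MeasurableSet {θ : Θ | M n * ε n < ‖(θ : EuclideanSpace ℝ (Fin k)) - θ₀‖} :=
    measurableSet_lt measurable_const (measurable_subtype_coe.sub_const _).norm
  have hAS : {θ : Θ | M n * ε n < ‖(θ : EuclideanSpace ℝ (Fin k)) - θ₀‖} ⊆ ⋃ j, S j := by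
    intro θ hθ
    have h1 : (m : ℝ) * ε n < D θ := by
      calc (m : ℝ) * ε n ≤ C * M n * ε n := by
            gcongr
            rwa [div_le_iff₀' hC] at hMn
        _ = C * (M n * ε n) := mul_assoc _ _ _
        _ < C * ‖(θ : EuclideanSpace ℝ (Fin k)) - θ₀‖ := by gcongr; exact hθ
        _ ≤ D θ := hmetric w hw θ
    exact Set.mem_iUnion.2 (exists_shell hεn h1)
  have hη : ∀ j, ∀ θ ∈ S j, ∫⁻ x, (1 - φ x) ∂(testLaw μ p θ₀ w θ) ≤
      ENNReal.ofReal (Real.exp (-(n * ε n ^ 2 * (((m + j) / 2 : ℕ) : ℝ) ^ 2))) := by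
    intro j θ hθ
    refine (hφQ ((m + j) / 2) w hw θ ?_).trans_eq (by congr 2; ring)
    refine lt_of_le_of_lt ?_ hθ.1
    have h2 : ((((m + j) / 2 : ℕ) : ℝ)) * 2 ≤ ((m + j : ℕ) : ℝ) := by
      exact_mod_cast Nat.div_mul_le_self (m + j) 2
    rw [← mul_assoc]
    gcongr
  have hρ : ∀ j, modifiedPrior μ p θ₀ (prior n) w (S j) /
      modifiedPrior μ p θ₀ (prior n) w (klNbhd μ p θ₀ w (ε n)) ≤
      ENNReal.ofReal (L * Real.exp (n * ε n ^ 2 * ((m + j : ℕ) : ℝ) ^ 2 / 8)) :=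
    fun j => hprior n hnN (m + j) (by omega) w hw
  refine (hp.lintegral_weightedPosterior_le θ₀ (prior n) hw.1 (hnorm w hw).1 (hnorm w hw).2 ha hφ
    hφ1 hA hAS hη (fun _ => ENNReal.ofReal_ne_top) hρ).trans ?_
  unfold contractionBound
  gcongr ?_ + _ + ?_
  · exact hφP.trans_eq (by congr 3; ring)
  · exact tsum_exp_shell_le ha.le hL.le (by omega)

end Contraction

end WeightedPosterior

/-! ### Averaging over the random weights -/

theorem theorem1 {k : ℕ} (Θ : Set (EuclideanSpace ℝ (Fin k)))
    {X : Type*} [MeasurableSpace X] (μ : Measure X) [SigmaFinite μ]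
    (p : Θ → X → ℝ≥0) (hp : WeightedPosterior.IsDensityFamily μ p) (θ₀ : Θ)
    (prior : ℕ → Measure Θ) [∀ n, IsProbabilityMeasure (prior n)]
    (W : (n : ℕ) → Measure (Fin n → ℝ)) [∀ n, IsProbabilityMeasure (W n)]
    (c₀ : ℝ) (hc₀ : 0 < c₀)
    (ε : ℕ → ℝ) (hε_pos : ∀ n, 0 < ε n) (hε : Tendsto ε atTop (𝓝 0))
    (hnε : Tendsto (fun n : ℕ => (n : ℝ) * ε n ^ 2) atTop atTop)
    (hW : Tendsto (fun n => W n (WeightedPosterior.weightSet n c₀)) atTop (𝓝 1))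
    (hdeg : WeightedPosterior.DegenerateOnlyAtTruth μ p θ₀)
    (hnorm : WeightedPosterior.Normalizable μ p θ₀ prior c₀)
    (d : (n : ℕ) → Measure (Fin n → X) → Measure (Fin n → X) → ℝ)
    (hd : ∀ n, WeightedPosterior.IsSemimetricOn {P | IsProbabilityMeasure P} (d n))
    (hmetric : WeightedPosterior.DominatesNorm μ p θ₀ c₀ d)
    (htest : WeightedPosterior.HasTests μ p θ₀ c₀ ε d)
    (hprior : WeightedPosterior.PriorRegular μ p θ₀ prior c₀ ε d) :
    ∀ M : ℕ → ℝ, Tendsto M atTop atTop →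
      Tendsto (fun n : ℕ =>
        ∫⁻ x, ∫⁻ w, WeightedPosterior.weightedPosterior p (prior n) w x
            {θ | M n * ε n < ‖(θ : EuclideanSpace ℝ (Fin k)) - θ₀‖} ∂(W n)
          ∂(WeightedPosterior.sampleLaw μ p n θ₀))
        atTop (𝓝 0) := by
  intro M hM
  obtain ⟨K, L, hbound⟩ := WeightedPosterior.eventually_lintegral_weightedPosterior_le μ p hp θ₀
    prior c₀ ε hε_pos hnorm d hmetric htest hprior M hM
  have hlim : Tendsto (fun n : ℕ => W n (WeightedPosterior.weightSet n c₀)ᶜ +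
      WeightedPosterior.contractionBound K L (n * ε n ^ 2)) atTop (𝓝 0) := by
    have h1 : Tendsto (fun n => W n (WeightedPosterior.weightSet n c₀)ᶜ) atTop (𝓝 0) := by
      simp_rw [prob_compl_eq_one_sub (WeightedPosterior.measurableSet_weightSet _ c₀)]
      simpa using ENNReal.Tendsto.sub (tendsto_const_nhds (x := (1 : ℝ≥0∞))) hW
        (.inl ENNReal.one_ne_top)
    simpa using h1.add ((WeightedPosterior.tendsto_contractionBound K L).comp hnε)
  refine tendsto_of_tendsto_of_tendsto_of_le_of_le' tendsto_const_nhds hlim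
    (.of_forall fun _ => zero_le) ?_
  filter_upwards [hbound] with n hn
  have := hp.isProbabilityMeasure_sampleLaw (n := n) θ₀
  have hR := WeightedPosterior.measurableSet_weightSet n c₀
  have hA : MeasurableSet {θ : Θ | M n * ε n < ‖(θ : EuclideanSpace ℝ (Fin k)) - θ₀‖} :=
    measurableSet_lt measurable_const (measurable_subtype_coe.sub_const _).norm
  -- Tonelli puts the weights outside, so that the bound for fixed `w` applies on the weight set and
  -- the trivial bound 1 off it.
  rw [lintegral_lintegral_swap (hp.measurable_weightedPosterior (prior n) hA).aemeasurable,
    ← lintegral_add_compl _ hR, add_comm]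
  gcongr
  · calc _ ≤ ∫⁻ w in (WeightedPosterior.weightSet n c₀)ᶜ, 1 ∂(W n) := by
          refine lintegral_mono fun w => ?_
          calc _ ≤ ∫⁻ _, 1 ∂(WeightedPosterior.sampleLaw μ p n θ₀) :=
                lintegral_mono fun x => WeightedPosterior.weightedPosterior_le_one _ w x hA
            _ = 1 := by simp
      _ = _ := setLIntegral_one _
  · calc _ ≤ ∫⁻ w in WeightedPosterior.weightSet n c₀,
          WeightedPosterior.contractionBound K L (n * ε n ^ 2) ∂(W n) :=
        setLIntegral_mono measurable_const hn
      _ ≤ _ := by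
        rw [setLIntegral_const]
        exact mul_le_of_le_one_right' prob_le_one
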